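/- A directed mixed graph on a vertex set $V$ has directed edges $v\to w$ (ordered pairs of distinct vertices; both $v\to w$ and $w\to v$ may be present) and bidirected edges $v\leftrightarrow w$ (unordered pairs of distinct vertices), and a pair of vertices may be joined by directed and bidirected edges at once. An ADMG is a directed mixed graph without directed cycles; a DCG is a directed mixed graph without bidirected edges, which may or may not contain directed cycles. A path between distinct vertices $v,w$ is a sequence of consecutive edges leading from $v$ to $w$, traversed in either direction; vertices may be repeated. An inner vertex is a collider on the path if both of the path's edges at it have an arrowhead there. For $Z\subseteq V\setminus\{v,w\}$, the path is active given $Z$ if no inner non-collider lies in $Z$ and every collider lies in $Z$ or has a descendant in $Z$ (a vertex reachable from it along directed edges). The vertices $v,w$ are d-connected given $Z$ if there is an active path between them given $Z$. Two graphs on $V$ are Markov equivalent if, for all distinct $v,w\in V$ and all $Z\subseteq V\setminus\{v,w\}$, $v$ and $w$ are d-connected given $Z$ in one graph if and only if they are in the other. For an ADMG (respectively DCG) $G$, $\mathrm{MEC}(G)$ is the set of all ADMGs (respectively DCGs) on the same vertex set that are Markov equivalent to $G$. **Theorem.** Let $G$ be uniformly distributed on the set of all ADMGs with vertex set $\{1,\dots,n\}$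 and let $H$ be uniformly distributed on the set of all DCGs with vertex set $\{1,\dots,n\}$. Then (a) $\mathbb{E}\,|\mathrm{MEC}(G)|\ge 2^{\Omega(n^2)}$, that is, there is a constant $c>0$ such that $\mathbb{E}\,|\mathrm{MEC}(G)|\ge 2^{cn^2}$ for all sufficiently large $n$; (b) $\mathbb{E}\,|\mathrm{MEC}(H)|\ge 2^{\Omega(n)}$, that is, there is a constant $c>0$ such that $\mathbb{E}\,|\mathrm{MEC}(H)|\ge 2^{cn}$ for all sufficiently large $n$. -/

import Mathlib

open Filter
open scoped BigOperators

/-- A directed mixed graph on the vertex set `V`: directed edges between distinct vertices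
(`dir v w` means `v → w`; both `v → w` and `w → v` may be present), together with bidirected
edges `v ↔ w`, which are unordered pairs of distinct vertices. A pair of vertices may be joined
by directed and bidirected edges at the same time. -/
@[ext]
structure MixedGraph (V : Type*) where
  dir : V → V → Prop
  dir_irrefl : ∀ v, ¬ dir v v
  bidir : SimpleGraph V

/-- The three ways of traversing an edge from `u` to `v`:
`fwd` along `u → v`, `bwd` along `u ← v`, `bi` along `u ↔ v`. -/
inductive EdgeKind
  | fwd
  | bwd
  | bi

namespace EdgeKind

/-- The traversed edge has an arrowhead at the vertex where the traversal starts. -/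
def HeadAtStart : EdgeKind → Prop
  | fwd => False
  | bwd => True
  | bi => True

/-- The traversed edge has an arrowhead at the vertex where the traversal ends. -/
def HeadAtEnd : EdgeKind → Prop
  | fwd => True
  | bwd => False
  | bi => True

end EdgeKind

namespace MixedGraph

variable {V : Type*}

/-- There is an edge of `G` that is traversed from `u` to `v` in the way `k`. -/
def Step (G : MixedGraph V) : EdgeKind → V → V → Prop
  | .fwd, u, v => G.dir u v
  | .bwd, u, v => G.dir v u
  | .bi, u, v => G.bidir.Adj u v

/-- `x` is a descendant of `v`: there is a directed path from `v` to `x ≠ v`. -/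
def IsDescendant (G : MixedGraph V) (v x : V) : Prop :=
  v ≠ x ∧ Relation.ReflTransGen G.dir v x

/-- `G` has no directed cycle. -/
def Acyclic (G : MixedGraph V) : Prop :=
  ∀ v, ¬ Relation.TransGen G.dir v v

/-- A possibly self-intersecting path, which records the edge used in each step. -/
inductive Walk (G : MixedGraph V) : V → V → Type _
  | nil (u : V) : Walk G u u
  | cons {u v w : V} (k : EdgeKind) (h : G.Step k u v) (p : Walk G v w) : Walk G u w

/-- An inner vertex `b` of a path that is entered by an edge of kind `k` and left by an edge of
kind `l` does not block the path given `Z`: if both edges have an arrowhead at `b` (so `b` is a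
collider) then `b` or a descendant of `b` lies in `Z`, and otherwise `b ∉ Z`. -/
def OpenAt (G : MixedGraph V) (Z : Set V) (k : EdgeKind) (b : V) (l : EdgeKind) : Prop :=
  (k.HeadAtEnd ∧ l.HeadAtStart → b ∈ Z ∨ ∃ d ∈ Z, G.IsDescendant b d) ∧
  (¬ (k.HeadAtEnd ∧ l.HeadAtStart) → b ∉ Z)

/-- The path is active given `Z`: no inner vertex blocks it. -/
def Walk.Active {G : MixedGraph V} (Z : Set V) : {u v : V} → Walk G u v → Prop
  | _, _, .nil _ => True
  | _, _, .cons _ _ (.nil _) => True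
  | _, _, .cons k _ (.cons (u := b) l h p) => G.OpenAt Z k b l ∧ Active Z (.cons l h p)

/-- `v` and `w` are d-connected given `Z` (used for `v ≠ w` and `v, w ∉ Z`). -/
def DConnected (G : MixedGraph V) (v w : V) (Z : Set V) : Prop :=
  ∃ p : Walk G v w, p.Active Z

/-- Two graphs on the same vertex set have the same d-connections. -/
def MarkovEquivalent (G H : MixedGraph V) : Prop :=
  ∀ (v w : V) (Z : Set V), v ≠ w → v ∉ Z → w ∉ Z →
    (G.DConnected v w Z ↔ H.DConnected v w Z)

/-- The Markov equivalence class of a graph `G` inside the model class `P`. -/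
def MEC {P : MixedGraph V → Prop} (G : {G : MixedGraph V // P G}) :
    Set {G : MixedGraph V // P G} :=
  {H | MarkovEquivalent G.1 H.1}

instance [Finite V] : Finite (MixedGraph V) :=
  Finite.of_injective (fun G : MixedGraph V => (G.dir, G.bidir)) (by
    intro G H h
    simp only [Prod.mk.injEq] at h
    exact MixedGraph.ext h.1 h.2)

noncomputable instance [Finite V] (P : MixedGraph V → Prop) :
    Fintype {G : MixedGraph V // P G} :=
  Fintype.ofFinite _

end MixedGraph

/-- The acyclic directed mixed graphs on the vertex set `Fin n`. -/
abbrev ADMG (n : ℕ) : Type :=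
  {G : MixedGraph (Fin n) // G.Acyclic}

/-- The directed graphs on the vertex set `Fin n`, which may or may not contain cycles: the
directed mixed graphs without bidirected edges. -/
abbrev DCG (n : ℕ) : Type :=
  {G : MixedGraph (Fin n) // G.bidir = ⊥}

namespace SimpleGraph

/-! Graphs with a hub have no separations, so they all lie in a single Markov equivalence class
(`IsHub.markovEquivalent`). A hub can be forced at a fixed vertex by rewriting only the edges there,
and this forgets at most `8 ^ n` possibilities. Hence, of the `N` graphs in the model class, at
least `N / 8 ^ n` are hub graphs, each with an equivalence class at least that large, and the mean
class size is at least `N / 64 ^ n` (`natCard_div_le_expect_ncard_MEC`). Since simple graphs embed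
into both model classes, `N ≥ 2 ^ n.choose 2`, which dwarfs `64 ^ n`. -/

theorem two_pow_choose_two_le_natCard (V : Type*) [Finite V] :
    2 ^ (Nat.card V).choose 2 ≤ Nat.card (SimpleGraph V) := by
  classical
  have := Fintype.ofFinite V
  have hinj : Function.Injective fun s : Set ((Sym2.diagSet : Set (Sym2 V))ᶜ : Set (Sym2 V)) =>
      fromEdgeSet (Subtype.val '' s) := by
    intro s t h
    have hdisj (u : Set ((Sym2.diagSet : Set (Sym2 V))ᶜ : Set (Sym2 V))) :
        Subtype.val '' u \ Sym2.diagSet = Subtype.val '' u := by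
      refine sdiff_eq_left.2 (Set.disjoint_left.2 ?_)
      rintro _ ⟨e, -, rfl⟩
      exact e.2
    have h' := congrArg edgeSet h
    simp only [edgeSet_fromEdgeSet, hdisj] at h'
    exact Subtype.val_injective.image_injective h'
  have hle := Nat.card_le_card_of_injective _ hinj
  rwa [Nat.card_eq_fintype_card, Fintype.card_set, Sym2.card_diagSet_compl,
    ← Nat.card_eq_fintype_card] at hle

end SimpleGraph

namespace MixedGraph

variable {V : Type*}

/-- A hub has an edge to every other vertex `v`, and another edge joining it to `v` that has an
arrowhead at the hub. -/
def IsHub (G : MixedGraph V) (x : V) : Prop :=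
  ∀ v, v ≠ x → G.dir x v ∧ (G.bidir.Adj x v ∨ G.dir v x)

/-- A graph with a hub has no separations at all: two vertices other than the hub `x` are
d-connected through `x`, which serves as a non-collider given `∅` and as a collider otherwise. -/
theorem IsHub.dConnected {G : MixedGraph V} {x : V} (hx : G.IsHub x) {v w : V} (hvw : v ≠ w)
    (Z : Set V) : G.DConnected v w Z := by
  by_cases hv : v = x
  · subst hv
    exact ⟨.cons .fwd (hx w hvw.symm).1 (.nil w), trivial⟩
  by_cases hw : w = x
  · subst hw
    exact ⟨.cons .bwd (hx v hv).1 (.nil w), trivial⟩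
  by_cases hZ : Z.Nonempty
  · obtain ⟨z, hz⟩ := hZ
    -- Every vertex other than `x` is a child of `x`, so any element of `Z` opens the collider at
    -- `x`.
    have hanc : x ∈ Z ∨ ∃ d ∈ Z, G.IsDescendant x d := by
      by_cases hzx : z = x
      · exact .inl (hzx ▸ hz)
      · exact .inr ⟨z, hz, Ne.symm hzx, .single (hx z hzx).1⟩
    have hin : ∃ k : EdgeKind, k.HeadAtEnd ∧ G.Step k v x := by
      rcases (hx v hv).2 with h | h
      · exact ⟨.bi, trivial, h.symm⟩
      · exact ⟨.fwd, trivial, h⟩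
    have hout : ∃ l : EdgeKind, l.HeadAtStart ∧ G.Step l x w := by
      rcases (hx w hw).2 with h | h
      · exact ⟨.bi, trivial, h⟩
      · exact ⟨.bwd, trivial, h⟩
    obtain ⟨k, hk, hkstep⟩ := hin
    obtain ⟨l, hl, hlstep⟩ := hout
    exact ⟨.cons k hkstep (.cons l hlstep (.nil w)),
      ⟨fun _ => hanc, fun h => absurd ⟨hk, hl⟩ h⟩, trivial⟩
  · rw [Set.not_nonempty_iff_eq_empty] at hZ
    subst hZ
    exact ⟨.cons .bwd (hx v hv).1 (.cons .fwd (hx w hw).1 (.nil w)),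
      ⟨fun h => h.1.elim, fun _ => Set.notMem_empty x⟩, trivial⟩

theorem IsHub.markovEquivalent {G H : MixedGraph V} {x y : V} (hG : G.IsHub x)
    (hH : H.IsHub y) : MarkovEquivalent G H :=
  fun _ _ Z hvw _ _ => iff_of_true (hG.dConnected hvw Z) (hH.dConnected hvw Z)

/-- The edges at the vertex `x`. -/
def star (G : MixedGraph V) (x : V) : (V → Prop) × (V → Prop) × (V → Prop) :=
  (G.dir x, fun v => G.dir v x, G.bidir.Adj x)

/-- If every graph of a model class can be given a hub at `x`, within the class and by changing
only edges at `x`, then the average Markov equivalence class is as large as the whole model class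
up to an exponential factor. -/
theorem natCard_div_le_expect_ncard_MEC [Finite V] {P : MixedGraph V → Prop} (x : V)
    (φ : {G : MixedGraph V // P G} → {G : MixedGraph V // P G})
    (hub : ∀ G, (φ G).1.IsHub x)
    (hinj : ∀ G H, φ G = φ H → G.1.star x = H.1.star x → G = H) :
    (Nat.card {G : MixedGraph V // P G} : ℝ) / 64 ^ Nat.card V
      ≤ 𝔼 G : {G : MixedGraph V // P G}, ((MEC G).ncard : ℝ) := by
  classical
  have := Fintype.ofFinite V
  rcases isEmpty_or_nonempty {G : MixedGraph V // P G} with hP | hP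
  · simp
  set S : Finset {G : MixedGraph V // P G} := Finset.univ.image φ with hS
  have hmem (G) : φ G ∈ S := Finset.mem_image_of_mem φ (Finset.mem_univ G)
  have hmec : ∀ G ∈ S, (S.card : ℝ) ≤ (MEC G).ncard := by
    intro G hG
    obtain ⟨G, -, rfl⟩ := Finset.mem_image.1 hG
    rw [← Set.ncard_coe_finset]
    refine Nat.cast_le.2 (Set.ncard_le_ncard ?_ (Set.toFinite _))
    intro H hH
    obtain ⟨H, -, rfl⟩ := Finset.mem_image.1 (Finset.mem_coe.1 hH)
    exact (hub G).markovEquivalent (hub H)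
  -- A fibre of `φ` embeds into the possible stars at `x`, which are triples of predicates on `V`.
  have hcard : Nat.card {G : MixedGraph V // P G} ≤ S.card * 8 ^ Nat.card V := by
    have hφ : Function.Injective fun G : {G : MixedGraph V // P G} =>
        ((⟨φ G, hmem G⟩ : S), G.1.star x) := by
      intro G H h
      simp only [Prod.mk.injEq, Subtype.mk.injEq] at h
      exact hinj G H h.1 h.2
    have hle := Fintype.card_le_of_injective _ hφ
    rw [← Nat.card_eq_fintype_card] at hle
    refine hle.trans_eq ?_
    simp only [Fintype.card_prod, Fintype.card_coe, Fintype.card_fun, Fintype.card_prop,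
      Nat.card_eq_fintype_card]
    rw [← mul_pow, ← mul_pow]
    norm_num
  -- Only the graphs in the image of `φ` are counted; each contributes at least the size of that
  -- image.
  have hsum : (S.card : ℝ) * S.card
      ≤ ∑ G : {G : MixedGraph V // P G}, ((MEC G).ncard : ℝ) :=
    calc (S.card : ℝ) * S.card = ∑ _G ∈ S, (S.card : ℝ) := by simp
      _ ≤ ∑ G ∈ S, ((MEC G).ncard : ℝ) := Finset.sum_le_sum hmec
      _ ≤ _ := Finset.sum_le_sum_of_subset_of_nonneg (Finset.subset_univ S)
          fun _ _ _ => Nat.cast_nonneg _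
  rw [Fintype.expect_eq_sum_div_card, ← Nat.card_eq_fintype_card]
  have hpos : (0 : ℝ) < Nat.card {G : MixedGraph V // P G} := Nat.cast_pos.2 Nat.card_pos
  rw [div_le_div_iff₀ (by positivity) hpos]
  have hcard' : (Nat.card {G : MixedGraph V // P G} : ℝ) ≤ S.card * 8 ^ Nat.card V := by
    exact_mod_cast hcard
  calc (Nat.card {G : MixedGraph V // P G} : ℝ) * Nat.card {G : MixedGraph V // P G}
      ≤ (S.card * 8 ^ Nat.card V) * (S.card * 8 ^ Nat.card V) :=
        mul_le_mul hcard' hcard' hpos.le (by positivity)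
    _ = (S.card * S.card) * 64 ^ Nat.card V := by
        rw [mul_mul_mul_comm, ← mul_pow]; norm_num
    _ ≤ _ := by gcongr

/-- Replace the edges at `x` by `x → v` and `x ↔ v` for all other vertices `v`. -/
def rootHub (G : MixedGraph V) (x : V) : MixedGraph V where
  dir u v := v ≠ x ∧ (u = x ∨ G.dir u v)
  dir_irrefl v h := h.2.elim h.1 (G.dir_irrefl v)
  bidir :=
    { Adj := fun u v => u ≠ v ∧ (u = x ∨ v = x ∨ G.bidir.Adj u v)
      symm := ⟨fun _ _ h => ⟨h.1.symm, by
        rcases h.2 with h | h | h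
        exacts [.inr (.inl h), .inl h, .inr (.inr h.symm)]⟩⟩
      loopless := ⟨fun _ h => h.1 rfl⟩ }

theorem isHub_rootHub (G : MixedGraph V) (x : V) : (G.rootHub x).IsHub x :=
  fun _ hv => ⟨⟨hv, .inl rfl⟩, .inl ⟨hv.symm, .inl rfl⟩⟩

/-- No directed edge enters `x`, so a directed cycle would avoid `x` and already lie in `G`. This is
why the arrowheads at `x` come from bidirected edges. -/
theorem Acyclic.rootHub {G : MixedGraph V} (hG : G.Acyclic) (x : V) : (G.rootHub x).Acyclic := by
  have key {u v : V} (h : Relation.TransGen (G.rootHub x).dir u v) :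
      v ≠ x ∧ (u ≠ x → Relation.TransGen G.dir u v) := by
    induction h with
    | single h => exact ⟨h.1, fun hu => .single (h.2.resolve_left hu)⟩
    | tail _ h ih => exact ⟨h.1, fun hu => (ih.2 hu).tail (h.2.resolve_left ih.1)⟩
  exact fun v h => hG v ((key h).2 (key h).1)

/-- Replace the directed edges at `x` by `x → v` and `v → x` for all other vertices `v`. -/
def cyclicHub (G : MixedGraph V) (x : V) : MixedGraph V where
  dir u v := u ≠ v ∧ (u = x ∨ v = x ∨ G.dir u v)
  dir_irrefl _ h := h.1 rfl
  bidir := G.bidir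

theorem isHub_cyclicHub (G : MixedGraph V) (x : V) : (G.cyclicHub x).IsHub x :=
  fun _ hv => ⟨⟨hv.symm, .inl rfl⟩, .inr ⟨hv, .inr (.inl rfl)⟩⟩

theorem ext_of_star {G H : MixedGraph V} {x : V} (hstar : G.star x = H.star x)
    (hdir : ∀ u v, u ≠ x → v ≠ x → (G.dir u v ↔ H.dir u v))
    (hbidir : ∀ u v, u ≠ x → v ≠ x → (G.bidir.Adj u v ↔ H.bidir.Adj u v)) : G = H := by
  simp only [star, Prod.mk.injEq, funext_iff, eq_iff_iff] at hstar
  obtain ⟨hout, hin, hbi⟩ := hstar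
  refine MixedGraph.ext (funext₂ fun u v => propext ?_) (SimpleGraph.ext (funext₂ fun u v =>
    propext ?_))
  · by_cases hu : u = x
    · exact hu ▸ hout v
    by_cases hv : v = x
    · exact hv ▸ hin u
    exact hdir u v hu hv
  · by_cases hu : u = x
    · exact hu ▸ hbi v
    by_cases hv : v = x
    · rw [G.bidir.adj_comm, H.bidir.adj_comm]
      exact hv ▸ hbi u
    exact hbidir u v hu hv

theorem eq_of_rootHub_eq {G H : MixedGraph V} {x : V} (h : G.rootHub x = H.rootHub x)
    (hstar : G.star x = H.star x) : G = H := by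
  refine ext_of_star hstar (fun u v hu hv => ?_) (fun u v hu hv => ?_)
  · have := congrFun₂ (congrArg dir h) u v
    simpa [rootHub, hu, hv] using this
  · by_cases huv : u = v
    · subst huv; simp
    have := congrFun₂ (congrArg (fun K => K.bidir.Adj) h) u v
    simpa [rootHub, hu, hv, huv] using this

theorem eq_of_cyclicHub_eq {G H : MixedGraph V} {x : V} (h : G.cyclicHub x = H.cyclicHub x)
    (hstar : G.star x = H.star x) : G = H := by
  refine ext_of_star hstar (fun u v hu hv => ?_) (fun u v _ _ => ?_)
  · by_cases huv : u = v
    · subst huv; exact iff_of_false (G.dir_irrefl u) (H.dir_irrefl u)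
    have := congrFun₂ (congrArg dir h) u v
    simpa [cyclicHub, hu, hv, huv] using this
  · have : (G.cyclicHub x).bidir = (H.cyclicHub x).bidir := by rw [h]
    simp only [cyclicHub] at this
    rw [this]

/-- The graph with the given bidirected edges and no directed edges. -/
def ofBidir (B : SimpleGraph V) : MixedGraph V where
  dir _ _ := False
  dir_irrefl _ := id
  bidir := B

theorem acyclic_ofBidir (B : SimpleGraph V) : (ofBidir B).Acyclic := fun v h => by
  obtain ⟨_, h, _⟩ := Relation.TransGen.head'_iff.1 h
  exact h

/-- The graph in which `u → v` and `v → u` for every edge of `B`. -/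
def ofSymmDir (B : SimpleGraph V) : MixedGraph V where
  dir := B.Adj
  dir_irrefl _ := B.irrefl
  bidir := ⊥

end MixedGraph

open MixedGraph

theorem two_pow_choose_two_le_natCard_ADMG (n : ℕ) : 2 ^ n.choose 2 ≤ Nat.card (ADMG n) := by
  have h := SimpleGraph.two_pow_choose_two_le_natCard (Fin n)
  rw [Nat.card_fin] at h
  exact h.trans (Nat.card_le_card_of_injective
    (fun B => (⟨ofBidir B, acyclic_ofBidir B⟩ : ADMG n))
    fun B C hBC => congrArg (fun G : ADMG n => G.1.bidir) hBC)

theorem two_pow_choose_two_le_natCard_DCG (n : ℕ) : 2 ^ n.choose 2 ≤ Nat.card (DCG n) := by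
  have h := SimpleGraph.two_pow_choose_two_le_natCard (Fin n)
  rw [Nat.card_fin] at h
  exact h.trans (Nat.card_le_card_of_injective
    (fun B => (⟨ofSymmDir B, rfl⟩ : DCG n))
    fun B C hBC => SimpleGraph.ext (congrArg (fun G : DCG n => G.1.dir) hBC))

theorem card_div_le_expect_ncard_MEC_ADMG {n : ℕ} (hn : 0 < n) :
    (Nat.card (ADMG n) : ℝ) / 64 ^ n ≤ 𝔼 G : ADMG n, ((MEC G).ncard : ℝ) := by
  have h := natCard_div_le_expect_ncard_MEC (P := Acyclic) (⟨0, hn⟩ : Fin n)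
    (fun G => ⟨G.1.rootHub _, G.2.rootHub _⟩) (fun G => G.1.isHub_rootHub _)
    (fun G H h hs => Subtype.ext (eq_of_rootHub_eq (congrArg Subtype.val h) hs))
  rwa [Nat.card_fin] at h

theorem card_div_le_expect_ncard_MEC_DCG {n : ℕ} (hn : 0 < n) :
    (Nat.card (DCG n) : ℝ) / 64 ^ n ≤ 𝔼 H : DCG n, ((MEC H).ncard : ℝ) := by
  have h := natCard_div_le_expect_ncard_MEC (P := fun G => G.bidir = ⊥) (⟨0, hn⟩ : Fin n)
    (fun G => ⟨G.1.cyclicHub _, G.2⟩) (fun G => G.1.isHub_cyclicHub _)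
    (fun G H h hs => Subtype.ext (eq_of_cyclicHub_eq (congrArg Subtype.val h) hs))
  rwa [Nat.card_fin] at h

/-- With `64 ^ n = 2 ^ (6 * n)`, the claim needs `n ^ 2 / 4 + 6 * n ≤ n * (n - 1) / 2`, with
equality at `n = 26`. -/
theorem two_rpow_sq_le_of_two_pow_choose_two_le {n N : ℕ} (hn : 26 ≤ n)
    (hN : 2 ^ n.choose 2 ≤ N) : (2 : ℝ) ^ (1 / 4 * (n : ℝ) ^ 2) ≤ (N : ℝ) / 64 ^ n := by
  have hn' : (26 : ℝ) ≤ n := by exact_mod_cast hn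
  have hN' : (2 : ℝ) ^ n.choose 2 ≤ N := by exact_mod_cast hN
  rw [le_div_iff₀ (by positivity)]
  refine le_trans ?_ hN'
  have h64 : (64 : ℝ) ^ n = 2 ^ (6 * n : ℝ) := by
    rw [Real.rpow_mul (by norm_num), Real.rpow_natCast]; norm_num
  rw [h64, ← Real.rpow_add (by norm_num), ← Real.rpow_natCast 2 (n.choose 2),
    Nat.cast_choose_two]
  exact Real.rpow_le_rpow_of_exponent_le (by norm_num) (by nlinarith)

theorem theorem2 :
    (∃ c : ℝ, 0 < c ∧ ∀ᶠ n : ℕ in atTop,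
      (2 : ℝ) ^ (c * (n : ℝ) ^ 2) ≤ 𝔼 G : ADMG n, ((MixedGraph.MEC G).ncard : ℝ)) ∧
    (∃ c : ℝ, 0 < c ∧ ∀ᶠ n : ℕ in atTop,
      (2 : ℝ) ^ (c * (n : ℝ)) ≤ 𝔼 H : DCG n, ((MixedGraph.MEC H).ncard : ℝ)) := by
  refine ⟨⟨1 / 4, by norm_num, ?_⟩, ⟨1 / 4, by norm_num, ?_⟩⟩
  · filter_upwards [eventually_ge_atTop 26] with n hn
    exact (two_rpow_sq_le_of_two_pow_choose_two_le hn
      (two_pow_choose_two_le_natCard_ADMG n)).trans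
      (card_div_le_expect_ncard_MEC_ADMG (by omega))
  · filter_upwards [eventually_ge_atTop 26] with n hn
    have hn' : (26 : ℝ) ≤ n := by exact_mod_cast hn
    -- The argument gives a quadratic exponent for DCGs too; it is weakened here to a linear one.
    refine le_trans (Real.rpow_le_rpow_of_exponent_le (by norm_num) (by nlinarith))
      ((two_rpow_sq_le_of_two_pow_choose_two_le hn
        (two_pow_choose_two_le_natCard_DCG n)).trans
        (card_div_le_expect_ncard_MEC_DCG (by omega)))
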